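/- There is an absolute constant $c>0$ with the following property. Let $M\ge 3$ clients, $K\ge 2$ arms and a horizon $T\ge 1$ be given, and let the communication graph $G_t$ on the clients be complete at every time step $t=1,\dots,T$. Then there is a problem instance of the adversarial decentralized multi-agent multi-armed bandit problem on which every online distributed learning algorithm has regret at least $c\sqrt T$. Here a problem instance consists of finitely many scenarios $\theta$ with probabilities $p_\theta$ and, for each scenario, a probability distribution $P_\theta$ of the rewards $r_i^m(t)\in[0,1]$ of the arms $i\le K$ for the clients $m\le M$ at the times $t\le T$. The adversary draws the scenario at random, keeps it hidden, and then draws the rewards from $P_\theta$. The instance can moreover be chosen stochastic in every scenario: under each $P_\theta$ the reward arrays $(r_i^m(t))_{m,i}$, $t=1,\dots,T$, are independent and identically distributed. In an online distributed learning algorithm each client $m$ pulls at each time $t$ one arm $a_m^t$, observes only the reward $r^m_{a_m^t}(t)$, and then sends everything it knows to its neighbours in $G_t$; the arm $a_m^t$ is a measurable function of the pulled arms and rewards known to client $m$ before time $t$ and of a random seed that is independent of the scenario and the rewards (the seed may be shared by the clients). The regret of the algorithm is the pseudo-regret in the hidden scenario, averaged over the scenarios, $$\sum_\theta p_\theta\Big(\max_{1\le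 i\le K}\mathbb E_\theta\Big[\sum_{t=1}^T\frac1M\sum_{m=1}^M r_i^m(t)\Big]-\mathbb E_\theta\Big[\frac1M\sum_{t=1}^T\sum_{m=1}^M r^m_{a_m^t}(t)\Big]\Big).$$ -/

import Mathlib

open MeasureTheory

universe u

/-- A reward table: `r t m i` is the reward of arm `i` for client `m` at time step `t`
(the `T` time steps are labelled `0, …, T - 1`). -/
abbrev RewardTable (T M K : ℕ) : Type := Fin T → Fin M → Fin K → ℝ

/-- The observations that have reached client `m` when it has to act at time step `t`.
The pair `(s, j)` stands for the arm that client `j` pulled at time step `s`, together with the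
reward that it received for it.  At the end of each time step every client passes all that it
knows, including its newest observation, to its current neighbours. -/
def visible {T M : ℕ} (G : Fin T → SimpleGraph (Fin M)) : ℕ → Fin M → Set (Fin T × Fin M)
  | 0, _ => ∅
  | t + 1, m => {p | ∃ h : t < T, ∃ j : Fin M, (j = m ∨ (G ⟨t, h⟩).Adj m j) ∧
      (p = (⟨t, h⟩, j) ∨ p ∈ visible G t j)}

/-- Only observations from earlier time steps are visible. -/
theorem visible_lt {T M : ℕ} (G : Fin T → SimpleGraph (Fin M)) (t : ℕ) (m : Fin M)
    (p : Fin T × Fin M) (hp : p ∈ visible G t m) : (p.1 : ℕ) < t := by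
  induction t generalizing m with
  | zero => exact absurd hp (Set.notMem_empty p)
  | succ t ih =>
    obtain ⟨h, j, -, rfl | hp⟩ := hp
    · exact Nat.lt_succ_self t
    · exact (ih j hp).trans (Nat.lt_succ_self t)

/-- A (randomized) online distributed bandit algorithm for `M` clients with `K` arms on the
graphs `G t`.  At time step `t` client `m` chooses its arm as a function of a random seed, drawn
once and independently of the rewards, and of the pulled arms and obtained rewards that
have reached it.  The seed may be common to the clients or consist of private parts. -/
structure DistributedAlgorithm {T M : ℕ} (G : Fin T → SimpleGraph (Fin M)) (K : ℕ) where
  /-- the space of random seeds -/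
  Seed : Type u
  /-- the events of the seed space -/
  [measurableSeed : MeasurableSpace Seed]
  /-- the distribution of the seed -/
  seedLaw : Measure Seed
  [isProbabilitySeed : IsProbabilityMeasure seedLaw]
  /-- the choice of an arm -/
  act : (t : Fin T) → (m : Fin M) → Seed → (visible G t m → Fin K × ℝ) → Fin K
  measurable_act : ∀ (t : Fin T) (m : Fin M), Measurable
    fun x : Seed × (visible G t m → Fin K × ℝ) => act t m x.1 x.2

attribute [instance] DistributedAlgorithm.measurableSeed DistributedAlgorithm.isProbabilitySeed

/-- The arm `a_m^t` that client `m` pulls at time step `t` when the algorithm with seed `ω` faces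
the reward table `r`. -/
def DistributedAlgorithm.play {T M K : ℕ} {G : Fin T → SimpleGraph (Fin M)}
    (A : DistributedAlgorithm.{u} G K) (r : RewardTable T M K) (ω : A.Seed)
    (t : Fin T) (m : Fin M) : Fin K :=
  A.act t m ω fun p : visible G t m =>
    (A.play r ω p.1.1 p.1.2, r p.1.1 p.1.2 (A.play r ω p.1.1 p.1.2))
termination_by t.val
decreasing_by all_goals exact visible_lt G t m p.1 p.2

/-- An instance of the adversarial problem: the adversary selects one of finitely many scenarios
at random and keeps it hidden from the clients; in scenario `θ` it draws the reward table, with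
entries in `[0, 1]`, from the distribution `law θ`.  (One scenario with a Dirac measure is
a deterministic reward table.) -/
structure AdversarialInstance (T M K : ℕ) where
  /-- the number of scenarios -/
  n : ℕ
  /-- the probabilities of the scenarios -/
  prior : Fin n → ℝ
  prior_nonneg : ∀ θ, 0 ≤ prior θ
  prior_sum : ∑ θ, prior θ = 1
  /-- the distribution of the reward table in each scenario -/
  law : Fin n → Measure (RewardTable T M K)
  isProbability_law : ∀ θ, IsProbabilityMeasure (law θ)
  mem_Icc : ∀ θ, ∀ᵐ r ∂(law θ), ∀ t m i, r t m i ∈ Set.Icc (0 : ℝ) 1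

/-- A distribution of reward tables is stochastic if the rewards are
independent and identically distributed across time. -/
def IsStochastic {T M K : ℕ} (P : Measure (RewardTable T M K)) : Prop :=
  ∃ ν : Measure (Fin M → Fin K → ℝ), IsProbabilityMeasure ν ∧ P = Measure.pi fun _ : Fin T => ν

/-- The global reward `r_i(t)` of arm `i` at time step `t`. -/
noncomputable def globalReward {T M K : ℕ} (r : RewardTable T M K) (t : Fin T) (i : Fin K) : ℝ :=
  (1 / (M : ℝ)) * ∑ m, r t m i

/-- The (pseudo) regret of an algorithm when the reward table is drawn from `P`: the largest
expected cumulative global reward of a fixed arm, minus the expected cumulative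
reward of the algorithm, averaged over the clients. -/
noncomputable def pseudoRegret {T M K : ℕ} {G : Fin T → SimpleGraph (Fin M)}
    (P : Measure (RewardTable T M K)) (A : DistributedAlgorithm.{u} G K) : ℝ :=
  (⨆ i : Fin K, ∫ r, ∑ t, globalReward r t i ∂P) -
    ∫ x : RewardTable T M K × A.Seed,
      (1 / (M : ℝ)) * ∑ t, ∑ m, x.1 t m (A.play x.1 x.2 t m) ∂(P.prod A.seedLaw)

/-- The expected regret of an algorithm on an instance: the regret in the hidden scenario,
averaged over the scenarios. -/
noncomputable def AdversarialInstance.regret {T M K : ℕ} {G : Fin T → SimpleGraph (Fin M)}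
    (I : AdversarialInstance T M K) (A : DistributedAlgorithm.{u} G K) : ℝ :=
  ∑ θ, I.prior θ * pseudoRegret (I.law θ) A

/-!
The adversary tosses one coin per time step and uses it for all clients: arm `0` pays `1` on heads
and every other arm pays `1` on tails. The coin has bias `1/2 + ε` in one scenario and
`1/2 - ε` in the other, with `ε = 1 / (4 √T)`, and both scenarios are equally likely.

Pulling an arm then amounts to predicting the coin, and a client that acts at time `t` knows at most
the seed and the earlier tosses (`DistributedAlgorithm.play_congr`), however the graph is
chosen. Its prediction is therefore independent of the current toss, so that it earns in expectation
the probability of the side that it predicts (`sum_weight_mul_ite_eq`). The prediction is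
wrong in one of the two scenarios, at a cost of `2ε`, and the two laws of the tosses overlap too much
for the algorithm to tell them apart: the sum over all toss sequences of the smaller of the two
probabilities is at least `3/8`. This follows from the Cauchy-Schwarz inequality, because the product
of the two probabilities of a sequence is `(1/4 - ε²) ^ T`, whatever the sequence
(`three_eighths_le_sum_min`). Hence the average regret is at least `ε T * 3/8`.
-/

/-! ### Tosses of a biased coin -/

/-- The probability that a coin with bias `p` shows `b`, where `true` stands for heads. -/
def coinWeight (p : ℝ) (b : Bool) : ℝ := if b then p else 1 - p

/-- The law of one toss of a coin with bias `p`. It is a probability measure for `p ∈ [0, 1]`. -/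
noncomputable def coin (p : ℝ) : Measure Bool :=
  ENNReal.ofReal p • Measure.dirac true + ENNReal.ofReal (1 - p) • Measure.dirac false

theorem coinWeight_nonneg {p : ℝ} (hp : p ∈ Set.Icc (0 : ℝ) 1) (b : Bool) : 0 ≤ coinWeight p b := by
  cases b <;> simp [coinWeight, hp.1, hp.2]

theorem sum_coinWeight (p : ℝ) : ∑ b, coinWeight p b = 1 := by
  simp [coinWeight]

theorem isProbabilityMeasure_coin {p : ℝ} (hp : p ∈ Set.Icc (0 : ℝ) 1) :
    IsProbabilityMeasure (coin p) := by
  constructor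
  simp [coin, ← ENNReal.ofReal_add hp.1 (sub_nonneg.2 hp.2)]

theorem coin_real_singleton {p : ℝ} (hp : p ∈ Set.Icc (0 : ℝ) 1) (b : Bool) :
    (coin p).real {b} = coinWeight p b := by
  cases b <;> simp [coin, coinWeight, Measure.real, hp.1, hp.2]

/-- The probability of the sequence `b` of independent tosses of a coin with bias `p`. -/
def tossWeight {T : ℕ} (p : ℝ) (b : Fin T → Bool) : ℝ := ∏ t, coinWeight p (b t)

theorem tossWeight_nonneg {T : ℕ} {p : ℝ} (hp : p ∈ Set.Icc (0 : ℝ) 1) (b : Fin T → Bool) :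
    0 ≤ tossWeight p b :=
  Finset.prod_nonneg fun t _ => coinWeight_nonneg hp (b t)

theorem sum_tossWeight (T : ℕ) (p : ℝ) : ∑ b : Fin T → Bool, tossWeight p b = 1 := by
  simp only [tossWeight]
  rw [← Fintype.sum_pow, sum_coinWeight, one_pow]

theorem integral_pi_coin {T : ℕ} {p : ℝ} (hp : p ∈ Set.Icc (0 : ℝ) 1) (f : (Fin T → Bool) → ℝ) :
    ∫ b, f b ∂(Measure.pi fun _ : Fin T => coin p) = ∑ b, tossWeight p b * f b := by
  have := isProbabilityMeasure_coin hp
  rw [integral_fintype (Integrable.of_finite)]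
  refine Finset.sum_congr rfl fun b _ => ?_
  rw [smul_eq_mul, tossWeight, Measure.real, Measure.pi_singleton, ENNReal.toReal_prod]
  congr 1
  exact Finset.prod_congr rfl fun t _ => coin_real_singleton hp (b t)

/-- A prediction `e` of the `t`-th toss that does not depend on that toss is correct with the
probability of the predicted side. -/
theorem sum_weight_mul_ite_eq {T : ℕ} (p : ℝ) (t : Fin T) (e : (Fin T → Bool) → Bool)
    (he : ∀ b v, e (Function.update b t v) = e b) :
    ∑ b, tossWeight p b * (if e b = b t then 1 else 0) =
      ∑ b, tossWeight p b * coinWeight p (e b) := by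
  -- Inverting the `t`-th toss pairs the sequences so that the differences of the terms cancel.
  have hinv : Function.Involutive fun b : Fin T → Bool => Function.update b t (!b t) := by
    intro b; simp
  set D : (Fin T → Bool) → ℝ := fun b =>
    tossWeight p b * (if e b = b t then 1 else 0) - tossWeight p b * coinWeight p (e b) with hD
  have hpair : ∀ b, D b + D (Function.update b t (!b t)) = 0 := by
    intro b
    have h1 : ∀ b : Fin T → Bool, tossWeight p b =
        coinWeight p (b t) * ∏ s ∈ Finset.univ.erase t, coinWeight p (b s) := fun b =>
      (Finset.mul_prod_erase _ _ (Finset.mem_univ t)).symm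
    have h2 : ∏ s ∈ Finset.univ.erase t, coinWeight p (Function.update b t (!b t) s) =
        ∏ s ∈ Finset.univ.erase t, coinWeight p (b s) :=
      Finset.prod_congr rfl fun s hs => by rw [Function.update_of_ne (Finset.ne_of_mem_erase hs)]
    simp only [hD, he, h1, h2, Function.update_self]
    cases e b <;> cases b t <;> simp [coinWeight] <;> ring
  have hsum : ∑ b, D b + ∑ b, D b = 0 := by
    nth_rewrite 2 [← Equiv.sum_comp hinv.toPerm D]
    rw [← Finset.sum_add_distrib]
    exact Finset.sum_eq_zero fun b _ => hpair b
  have : ∑ b, D b = 0 := by linarith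
  rw [hD, Finset.sum_sub_distrib] at this
  linarith

/-- For `ε = 1 / (4 √T)` the laws of `T` tosses with the biases `1 / 2 + ε` and `1 / 2 - ε` overlap
by a constant: the product of the two probabilities is the same for all sequences, so the
Cauchy-Schwarz inequality for `min` and `max` bounds the sum of the minima below by
`(1 - 4 ε ^ 2) ^ T / 2`. -/
theorem three_eighths_le_sum_min {T : ℕ} {ε : ℝ} (hε : ε ∈ Set.Icc (0 : ℝ) (1 / 4))
    (hT : T * ε ^ 2 = 1 / 16) :
    3 / 8 ≤ ∑ b : Fin T → Bool, min (tossWeight (1 / 2 + ε) b) (tossWeight (1 / 2 - ε) b) := by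
  obtain ⟨h0, h1⟩ := hε
  have hp : (1 / 2 + ε) ∈ Set.Icc (0 : ℝ) 1 := ⟨by linarith, by linarith⟩
  have hq : (1 / 2 - ε) ∈ Set.Icc (0 : ℝ) 1 := ⟨by linarith, by linarith⟩
  have hκ : (0 : ℝ) ≤ (1 / 4 - ε ^ 2) ^ T := pow_nonneg (by nlinarith) T
  have hprod : ∀ b : Fin T → Bool,
      tossWeight (1 / 2 + ε) b * tossWeight (1 / 2 - ε) b = (1 / 4 - ε ^ 2) ^ T := by
    intro b
    rw [tossWeight, tossWeight, ← Finset.prod_mul_distrib, Finset.prod_eq_pow_card (b := 1 / 4 - ε ^ 2)]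
    · simp
    · intro t _
      cases b t <;> simp [coinWeight] <;> ring
  have hcs := Finset.sum_sq_le_sum_mul_sum_of_sq_le_mul
    (Finset.univ : Finset (Fin T → Bool))
    (f := fun b => min (tossWeight (1 / 2 + ε) b) (tossWeight (1 / 2 - ε) b))
    (g := fun b => max (tossWeight (1 / 2 + ε) b) (tossWeight (1 / 2 - ε) b))
    (r := fun _ => √((1 / 4 - ε ^ 2) ^ T))
    (fun b _ => le_min (tossWeight_nonneg hp b) (tossWeight_nonneg hq b))
    (fun b _ => le_max_of_le_left (tossWeight_nonneg hp b))
    (fun b _ => by rw [Real.sq_sqrt hκ, min_mul_max, hprod])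
  have hmax : ∑ b : Fin T → Bool, max (tossWeight (1 / 2 + ε) b) (tossWeight (1 / 2 - ε) b) ≤ 2 := by
    calc _ ≤ ∑ b : Fin T → Bool, (tossWeight (1 / 2 + ε) b + tossWeight (1 / 2 - ε) b) :=
          Finset.sum_le_sum fun b _ =>
            max_le_add_of_nonneg (tossWeight_nonneg hp b) (tossWeight_nonneg hq b)
      _ = 2 := by rw [Finset.sum_add_distrib, sum_tossWeight, sum_tossWeight]; norm_num
  have hmin : 0 ≤ ∑ b : Fin T → Bool, min (tossWeight (1 / 2 + ε) b) (tossWeight (1 / 2 - ε) b) :=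
    Finset.sum_nonneg fun b _ => le_min (tossWeight_nonneg hp b) (tossWeight_nonneg hq b)
  have hlhs : (∑ _b : Fin T → Bool, √((1 / 4 - ε ^ 2) ^ T)) ^ 2 = (1 - 4 * ε ^ 2) ^ T := by
    simp only [Finset.sum_const, Finset.card_univ, Fintype.card_fun, Fintype.card_bool,
      Fintype.card_fin, nsmul_eq_mul]
    rw [mul_pow, Real.sq_sqrt hκ]
    push_cast
    rw [← pow_mul, mul_comm T 2, pow_mul, ← mul_pow]
    congr 1
    ring
  have hbern : 1 + (T : ℝ) * (-(4 * ε ^ 2)) ≤ (1 + -(4 * ε ^ 2)) ^ T :=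
    one_add_mul_le_pow (by nlinarith) T
  rw [← sub_eq_add_neg 1 (4 * ε ^ 2)] at hbern
  rw [hlhs] at hcs
  nlinarith [mul_le_mul_of_nonneg_left hmax hmin]

/-- No prediction `e` is good for both biases: added up over the two, its probability of being
correct is at most `1 + 2 ε`, and each sequence `b` loses `2 ε` under the bias for which `e b` is the
less likely side. -/
theorem sum_weight_prediction_le {T : ℕ} {ε : ℝ} (hε : ε ∈ Set.Icc (0 : ℝ) (1 / 4))
    (hT : T * ε ^ 2 = 1 / 16) (e : (Fin T → Bool) → Bool) :
    ∑ b, tossWeight (1 / 2 + ε) b * coinWeight (1 / 2 + ε) (e b) +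
      ∑ b, tossWeight (1 / 2 - ε) b * coinWeight (1 / 2 - ε) (e b) ≤ 1 + 2 * ε - 3 / 4 * ε := by
  have h0 := hε.1
  have hmin := mul_le_mul_of_nonneg_left (three_eighths_le_sum_min hε hT) h0
  have key : ∀ b : Fin T → Bool,
      tossWeight (1 / 2 + ε) b * coinWeight (1 / 2 + ε) (e b) +
        tossWeight (1 / 2 - ε) b * coinWeight (1 / 2 - ε) (e b) ≤
      (1 / 2 + ε) * tossWeight (1 / 2 + ε) b + (1 / 2 + ε) * tossWeight (1 / 2 - ε) b -
        2 * (ε * min (tossWeight (1 / 2 + ε) b) (tossWeight (1 / 2 - ε) b)) := by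
    intro b
    have hl := mul_le_mul_of_nonneg_left
      (min_le_left (tossWeight (1 / 2 + ε) b) (tossWeight (1 / 2 - ε) b)) h0
    have hr := mul_le_mul_of_nonneg_left
      (min_le_right (tossWeight (1 / 2 + ε) b) (tossWeight (1 / 2 - ε) b)) h0
    cases e b <;> simp only [coinWeight, if_true, Bool.false_eq_true, if_false] <;> linarith
  rw [← Finset.sum_add_distrib]
  refine (Finset.sum_le_sum fun b _ => key b).trans ?_
  rw [Finset.sum_sub_distrib, Finset.sum_add_distrib, ← Finset.mul_sum, ← Finset.mul_sum,
    ← Finset.mul_sum, ← Finset.mul_sum, sum_tossWeight, sum_tossWeight]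
  linarith

/-! ### Plays of an algorithm -/

/-- Before time `t` no reward of time `t` or later is known to any client. -/
theorem DistributedAlgorithm.play_congr {T M K : ℕ} {G : Fin T → SimpleGraph (Fin M)}
    (A : DistributedAlgorithm.{u} G K) {r r' : RewardTable T M K} (ω : A.Seed) (t : Fin T)
    (m : Fin M) (h : ∀ s < t, r s = r' s) : A.play r ω t m = A.play r' ω t m := by
  induction t using WellFoundedLT.induction generalizing m with
  | _ t ih =>
    rw [DistributedAlgorithm.play, DistributedAlgorithm.play]
    congr 1
    funext p
    have hlt : p.1.1 < t := visible_lt G t m p.1 p.2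
    rw [ih p.1.1 hlt p.1.2 fun s hs => h s (hs.trans hlt), h p.1.1 hlt]

theorem measurable_apply_apply {α : Type*} [MeasurableSpace α] {K : ℕ} {f : α → Fin K → ℝ}
    {a : α → Fin K} (hf : Measurable f) (ha : Measurable a) : Measurable fun x => f x (a x) := by
  have h : Measurable fun y : (Fin K → ℝ) × Fin K => y.1 y.2 :=
    measurable_from_prod_countable_left fun i => measurable_pi_apply i
  exact h.comp (hf.prodMk ha)

theorem DistributedAlgorithm.measurable_play {T M K : ℕ} {G : Fin T → SimpleGraph (Fin M)}
    (A : DistributedAlgorithm.{u} G K) (t : Fin T) (m : Fin M) :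
    Measurable fun x : RewardTable T M K × A.Seed => A.play x.1 x.2 t m := by
  induction t using WellFoundedLT.induction generalizing m with
  | _ t ih =>
    have hobs : Measurable fun (x : RewardTable T M K × A.Seed) (p : visible G t m) =>
        (A.play x.1 x.2 p.1.1 p.1.2, x.1 p.1.1 p.1.2 (A.play x.1 x.2 p.1.1 p.1.2)) := by
      refine measurable_pi_lambda _ fun p => ?_
      have hp := ih p.1.1 (visible_lt G t m p.1 p.2) p.1.2
      exact hp.prodMk (measurable_apply_apply (by fun_prop) hp)
    have := (A.measurable_act t m).comp (measurable_snd.prodMk hobs)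
    convert this using 2 with x
    rw [DistributedAlgorithm.play]
    rfl

/-! ### The instance and its regret -/

/-- The rewards paid after the toss `b`, which are the same for all clients: arm `0` pays on heads
and the other arms pay on tails. -/
def tossReward (M K : ℕ) (b : Bool) : Fin M → Fin K → ℝ :=
  fun _ i => if decide (i.val = 0) = b then 1 else 0

/-- The rewards of a sequence of tosses, one for each time step. -/
def tossTable (M K : ℕ) {T : ℕ} (b : Fin T → Bool) : RewardTable T M K :=
  fun t => tossReward M K (b t)

/-- The law of the reward table that is paid after independent tosses of a coin with bias `p`. -/
noncomputable def coinLaw (T M K : ℕ) (p : ℝ) : Measure (RewardTable T M K) :=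
  Measure.pi fun _ : Fin T => (coin p).map (tossReward M K)

section

variable {T M K : ℕ} {p : ℝ}

theorem isStochastic_coinLaw (hp : p ∈ Set.Icc (0 : ℝ) 1) : IsStochastic (coinLaw T M K p) := by
  have := isProbabilityMeasure_coin hp
  exact ⟨_, Measure.isProbabilityMeasure_map (measurable_of_countable _).aemeasurable, rfl⟩

theorem isProbabilityMeasure_coinLaw (hp : p ∈ Set.Icc (0 : ℝ) 1) :
    IsProbabilityMeasure (coinLaw T M K p) := by
  obtain ⟨ν, _, h⟩ := isStochastic_coinLaw (T := T) (M := M) (K := K) hp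
  rw [h]
  infer_instance

theorem coinLaw_eq_map (hp : p ∈ Set.Icc (0 : ℝ) 1) :
    coinLaw T M K p = (Measure.pi fun _ : Fin T => coin p).map (tossTable M K) := by
  have := isProbabilityMeasure_coin hp
  have : IsProbabilityMeasure ((coin p).map (tossReward M K)) :=
    Measure.isProbabilityMeasure_map (measurable_of_countable _).aemeasurable
  exact (Measure.pi_map_pi fun _ => (measurable_of_countable _).aemeasurable).symm

theorem tossTable_mem_Icc (b : Fin T → Bool) (t : Fin T) (m : Fin M) (i : Fin K) :
    tossTable M K b t m i ∈ Set.Icc (0 : ℝ) 1 := by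
  unfold tossTable tossReward
  split_ifs <;> simp

theorem ae_coinLaw_mem_Icc (hp : p ∈ Set.Icc (0 : ℝ) 1) :
    ∀ᵐ r ∂(coinLaw T M K p), ∀ t m i, r t m i ∈ Set.Icc (0 : ℝ) 1 := by
  rw [coinLaw_eq_map hp]
  refine (ae_map_iff (measurable_of_countable _).aemeasurable ?_).2
    (Filter.Eventually.of_forall tossTable_mem_Icc)
  simp only [Set.ofPred_forall]
  refine MeasurableSet.iInter fun t => MeasurableSet.iInter fun m => MeasurableSet.iInter fun i => ?_
  exact measurableSet_Icc.preimage (by fun_prop : Measurable fun r : RewardTable T M K => r t m i)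

theorem integral_globalReward_coinLaw (hM : M ≠ 0) (hp : p ∈ Set.Icc (0 : ℝ) 1) (i : Fin K) :
    ∫ r, ∑ t, globalReward r t i ∂(coinLaw T M K p) = T * coinWeight p (decide (i.val = 0)) := by
  have hmeas : Measurable fun r : RewardTable T M K => ∑ t, globalReward r t i := by
    unfold globalReward
    fun_prop
  rw [coinLaw_eq_map hp, integral_map (measurable_of_countable _).aemeasurable
    hmeas.aestronglyMeasurable, integral_pi_coin hp]
  simp only [Finset.mul_sum]
  rw [Finset.sum_comm]
  have hglobal : ∀ (b : Fin T → Bool) (t : Fin T), globalReward (tossTable M K b) t i =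
      if decide (i.val = 0) = b t then 1 else 0 := by
    intro b t
    have : (M : ℝ) ≠ 0 := by exact_mod_cast hM
    rw [globalReward]
    simp only [tossTable, tossReward, Finset.sum_const, Finset.card_univ, Fintype.card_fin,
      nsmul_eq_mul]
    field_simp
  simp only [hglobal]
  rw [Finset.sum_congr rfl fun t _ =>
    sum_weight_mul_ite_eq p t (fun _ => decide (i.val = 0)) fun _ _ => rfl]
  simp [← Finset.sum_mul, sum_tossWeight]

/-- With at least two arms, both sides of the coin are bet on by some arm. -/
theorem le_iSup_globalReward_coinLaw (hM : M ≠ 0) (hK : 2 ≤ K) (hp : p ∈ Set.Icc (0 : ℝ) 1)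
    (v : Bool) :
    T * coinWeight p v ≤ ⨆ i : Fin K, ∫ r, ∑ t, globalReward r t i ∂(coinLaw T M K p) := by
  have h : ∃ i : Fin K, decide (i.val = 0) = v := by
    cases v
    · exact ⟨⟨1, by omega⟩, by simp⟩
    · exact ⟨⟨0, by omega⟩, by simp⟩
  obtain ⟨i, rfl⟩ := h
  rw [← integral_globalReward_coinLaw hM hp i]
  exact le_ciSup (f := fun i : Fin K => ∫ r, ∑ t, globalReward r t i ∂(coinLaw T M K p))
    (Set.finite_range _).bddAbove i

variable {G : Fin T → SimpleGraph (Fin M)}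

/-- The expected number, averaged over the clients, of correct predictions of tosses with bias `p`
by the algorithm with seed `ω`. -/
noncomputable def expectedScore (A : DistributedAlgorithm.{u} G K) (p : ℝ) (ω : A.Seed) : ℝ :=
  (1 / (M : ℝ)) * ∑ t, ∑ m, ∑ b : Fin T → Bool, tossWeight p b *
    coinWeight p (decide ((A.play (tossTable M K b) ω t m).val = 0))

/-- Once the seed is fixed, a client's arm at time `t` is a function of the other tosses than the
`t`-th, so each reward may be replaced by its conditional expectation. -/
theorem DistributedAlgorithm.sum_tossWeight_mul_reward (A : DistributedAlgorithm.{u} G K) (p : ℝ)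
    (ω : A.Seed) :
    ∑ b : Fin T → Bool, tossWeight p b * ((1 / (M : ℝ)) * ∑ t, ∑ m,
      tossTable M K b t m (A.play (tossTable M K b) ω t m)) = expectedScore A p ω := by
  simp only [mul_left_comm _ (1 / (M : ℝ)), ← Finset.mul_sum, expectedScore]
  congr 1
  simp only [Finset.mul_sum]
  rw [Finset.sum_comm]
  refine Finset.sum_congr rfl fun t _ => ?_
  rw [Finset.sum_comm]
  refine Finset.sum_congr rfl fun m _ => ?_
  refine sum_weight_mul_ite_eq p t
    (fun b => decide ((A.play (tossTable M K b) ω t m).val = 0)) fun b v => ?_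
  have : A.play (tossTable M K (Function.update b t v)) ω t m = A.play (tossTable M K b) ω t m :=
    A.play_congr ω t m fun s hs => by simp [tossTable, Function.update_of_ne hs.ne]
  simp only [this]

theorem integrable_reward (A : DistributedAlgorithm.{u} G K) (hp : p ∈ Set.Icc (0 : ℝ) 1) :
    Integrable (fun x : (Fin T → Bool) × A.Seed => (1 / (M : ℝ)) * ∑ t, ∑ m,
      tossTable M K x.1 t m (A.play (tossTable M K x.1) x.2 t m))
      ((Measure.pi fun _ : Fin T => coin p).prod A.seedLaw) := by
  have := isProbabilityMeasure_coin hp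
  refine (integrable_finsetSum _ fun t _ => integrable_finsetSum _ fun m _ => ?_).const_mul _
  have hΦ : Measurable fun x : (Fin T → Bool) × A.Seed => (tossTable M K x.1, x.2) :=
    ((measurable_of_countable (tossTable M K)).comp measurable_fst).prodMk measurable_snd
  refine Integrable.of_bound (C := 1) (Measurable.aestronglyMeasurable ?_)
    (Filter.Eventually.of_forall fun x => ?_)
  · have h : Measurable fun x : RewardTable T M K × A.Seed => x.1 t m (A.play x.1 x.2 t m) :=
      measurable_apply_apply (by fun_prop) (A.measurable_play t m)
    exact h.comp hΦ
  · have h := tossTable_mem_Icc (M := M) (K := K) x.1 t m (A.play (tossTable M K x.1) x.2 t m)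
    rw [Real.norm_of_nonneg h.1]
    exact h.2

theorem integrable_expectedScore (A : DistributedAlgorithm.{u} G K) (hp : p ∈ Set.Icc (0 : ℝ) 1) :
    Integrable (expectedScore A p) A.seedLaw := by
  have := isProbabilityMeasure_coin hp
  have h := (integrable_reward A hp).integral_prod_right
  simpa only [integral_pi_coin hp, A.sum_tossWeight_mul_reward] using h

theorem integral_reward_coinLaw (A : DistributedAlgorithm.{u} G K) (hp : p ∈ Set.Icc (0 : ℝ) 1) :
    ∫ x : RewardTable T M K × A.Seed, (1 / (M : ℝ)) * ∑ t, ∑ m, x.1 t m (A.play x.1 x.2 t m)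
      ∂((coinLaw T M K p).prod A.seedLaw) = ∫ ω, expectedScore A p ω ∂A.seedLaw := by
  have := isProbabilityMeasure_coin hp
  have htable : Measurable (tossTable M K : (Fin T → Bool) → RewardTable T M K) :=
    measurable_of_countable _
  have hmap : (coinLaw T M K p).prod A.seedLaw =
      ((Measure.pi fun _ : Fin T => coin p).prod A.seedLaw).map
        (Prod.map (tossTable M K) id) := by
    rw [coinLaw_eq_map hp, ← Measure.map_prod_map _ _ htable measurable_id, Measure.map_id]
  have hmeas : Measurable fun x : RewardTable T M K × A.Seed =>
      (1 / (M : ℝ)) * ∑ t, ∑ m, x.1 t m (A.play x.1 x.2 t m) := by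
    refine (Finset.measurable_sum _ fun t _ => Finset.measurable_sum _ fun m _ => ?_).const_mul _
    exact measurable_apply_apply (by fun_prop) (A.measurable_play t m)
  rw [hmap, integral_map (htable.prodMap measurable_id).aemeasurable hmeas.aestronglyMeasurable]
  refine (integral_prod_symm _ (integrable_reward A hp)).trans ?_
  simp only [integral_pi_coin hp, A.sum_tossWeight_mul_reward]

theorem expectedScore_add_le {ε : ℝ} (hM : M ≠ 0) (hε : ε ∈ Set.Icc (0 : ℝ) (1 / 4))
    (hT : T * ε ^ 2 = 1 / 16) (A : DistributedAlgorithm.{u} G K) (ω : A.Seed) :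
    expectedScore A (1 / 2 + ε) ω + expectedScore A (1 / 2 - ε) ω ≤
      T * (1 + 2 * ε - 3 / 4 * ε) := by
  have hM' : (0 : ℝ) < M := by exact_mod_cast Nat.pos_of_ne_zero hM
  rw [expectedScore, expectedScore, ← mul_add]
  simp only [← Finset.sum_add_distrib]
  have h : ∑ t : Fin T, ∑ m : Fin M, _ ≤ ∑ t : Fin T, ∑ m : Fin M, (1 + 2 * ε - 3 / 4 * ε) :=
    Finset.sum_le_sum fun t _ => Finset.sum_le_sum fun m _ => sum_weight_prediction_le hε hT
      fun b => decide ((A.play (tossTable M K b) ω t m).val = 0)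
  simp only [← Finset.sum_add_distrib] at h
  refine (mul_le_mul_of_nonneg_left h (by positivity)).trans_eq ?_
  simp only [Finset.sum_const, Finset.card_univ, Fintype.card_fin, nsmul_eq_mul]
  field_simp

theorem pseudoRegret_add_ge {ε : ℝ} (hM : M ≠ 0) (hK : 2 ≤ K) (hε : ε ∈ Set.Icc (0 : ℝ) (1 / 4))
    (hT : T * ε ^ 2 = 1 / 16) (A : DistributedAlgorithm.{u} G K) :
    3 / 4 * (T * ε) ≤ pseudoRegret (coinLaw T M K (1 / 2 + ε)) A +
      pseudoRegret (coinLaw T M K (1 / 2 - ε)) A := by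
  have hp : (1 / 2 + ε) ∈ Set.Icc (0 : ℝ) 1 := ⟨by linarith [hε.1], by linarith [hε.2]⟩
  have hq : (1 / 2 - ε) ∈ Set.Icc (0 : ℝ) 1 := ⟨by linarith [hε.2], by linarith [hε.1]⟩
  have hbest₁ := le_iSup_globalReward_coinLaw (T := T) hM hK hp true
  have hbest₂ := le_iSup_globalReward_coinLaw (T := T) hM hK hq false
  have hscore : ∫ ω, expectedScore A (1 / 2 + ε) ω ∂A.seedLaw +
      ∫ ω, expectedScore A (1 / 2 - ε) ω ∂A.seedLaw ≤ T * (1 + 2 * ε - 3 / 4 * ε) := by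
    rw [← integral_add (integrable_expectedScore A hp) (integrable_expectedScore A hq)]
    refine (integral_mono ((integrable_expectedScore A hp).add (integrable_expectedScore A hq))
      (integrable_const _) fun ω => expectedScore_add_le hM hε hT A ω).trans_eq ?_
    simp
  simp only [coinWeight, if_true, Bool.false_eq_true, if_false] at hbest₁ hbest₂
  rw [pseudoRegret, pseudoRegret, integral_reward_coinLaw A hp, integral_reward_coinLaw A hq]
  linarith

end

/-- The hidden bias in the scenario `θ`. -/
noncomputable def scenarioBias (ε : ℝ) (θ : Fin 2) : ℝ := if θ = 0 then 1 / 2 + ε else 1 / 2 - ε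

theorem scenarioBias_mem_Icc {ε : ℝ} (hε : ε ∈ Set.Icc (0 : ℝ) (1 / 4)) (θ : Fin 2) :
    scenarioBias ε θ ∈ Set.Icc (0 : ℝ) 1 := by
  obtain ⟨h0, h1⟩ := hε
  unfold scenarioBias
  split_ifs <;> constructor <;> linarith

/-- The instance in which the adversary chooses one of the biases `1 / 2 + ε` and `1 / 2 - ε`, each
with probability `1 / 2`. -/
noncomputable def hiddenCoin (T M K : ℕ) {ε : ℝ} (hε : ε ∈ Set.Icc (0 : ℝ) (1 / 4)) :
    AdversarialInstance T M K where
  n := 2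
  prior _ := 1 / 2
  prior_nonneg _ := by norm_num
  prior_sum := by norm_num
  law θ := coinLaw T M K (scenarioBias ε θ)
  isProbability_law θ := isProbabilityMeasure_coinLaw (scenarioBias_mem_Icc hε θ)
  mem_Icc θ := ae_coinLaw_mem_Icc (scenarioBias_mem_Icc hε θ)

theorem theorem7 :
    ∃ c : ℝ, 0 < c ∧
      ∀ (M K T : ℕ), 3 ≤ M → 2 ≤ K → 1 ≤ T →
        ∀ G : Fin T → SimpleGraph (Fin M), (∀ t, G t = ⊤) →
          ∃ I : AdversarialInstance T M K,
            (∀ θ, IsStochastic (I.law θ)) ∧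
            ∀ A : DistributedAlgorithm.{u} G K, c * Real.sqrt (T : ℝ) ≤ I.regret A := by
  refine ⟨3 / 32, by norm_num, fun M K T hM hK hT G _ => ?_⟩
  have hT1 : (1 : ℝ) ≤ √(T : ℝ) := Real.one_le_sqrt.2 (by exact_mod_cast hT)
  have hsq : √(T : ℝ) ^ 2 = T := Real.sq_sqrt (Nat.cast_nonneg T)
  have hε : 1 / (4 * √(T : ℝ)) ∈ Set.Icc (0 : ℝ) (1 / 4) :=
    ⟨by positivity, one_div_le_one_div_of_le (by norm_num) (by linarith)⟩
  have hTε : T * (1 / (4 * √(T : ℝ))) ^ 2 = 1 / 16 := by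
    rw [div_pow, mul_pow, hsq]
    have : (T : ℝ) ≠ 0 := by exact_mod_cast (by omega : T ≠ 0)
    field_simp
    norm_num
  have hTε' : (T : ℝ) * (1 / (4 * √(T : ℝ))) = √(T : ℝ) / 4 := by
    nth_rewrite 1 [← hsq]
    field_simp
  refine ⟨hiddenCoin T M K hε, fun θ => isStochastic_coinLaw (scenarioBias_mem_Icc hε θ),
    fun A => ?_⟩
  have h := pseudoRegret_add_ge (by omega : M ≠ 0) hK hε hTε A
  have hreg : (hiddenCoin T M K hε).regret A =
      1 / 2 * pseudoRegret (coinLaw T M K (1 / 2 + 1 / (4 * √(T : ℝ)))) A +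
      1 / 2 * pseudoRegret (coinLaw T M K (1 / 2 - 1 / (4 * √(T : ℝ)))) A :=
    Fin.sum_univ_two _
  rw [hTε'] at h
  rw [hreg]
  linarith
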